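/- For $v\in\mathbb{C}\setminus\{0,-1,-2,\dots\}$ let $\zeta(s,v)$ be the Hurwitz zeta function, the analytic continuation in $s$ of $\sum_{j\ge 0}(j+v)^{-s}$ ($\operatorname{Re}s>1$, principal powers), and let $\gamma_k(v)$ be the generalized Stieltjes constants, defined by the Laurent expansion at $s=1$ $$\zeta(s,v)=\frac1{s-1}+\sum_{k\ge 0}\frac{(-1)^k}{k!}\,\gamma_k(v)\,(s-1)^k .$$ Let $\psi^{(0)}=\Gamma'/\Gamma$ be the digamma function, $H_z=\psi^{(0)}(z+1)+\gamma$ the harmonic number of complex index $z$ (with $\gamma$ Euler's constant), and $\log$ the principal logarithm. Let $n\ge 0$ be an integer and let $a\in\mathbb{C}$ be such that $2^n a\notin\{-1,-2,-3,\dots\}$ (equivalently, no term below is evaluated at a pole). Then $$\begin{aligned} \sum_{p=0}^{n}\Big(&\log(i2^{1-p})\big(H_{2^{p-2}a}-H_{\frac14(2^pa-2)}\big)+2\log(i2^{-p})\big(H_{\frac12(2^pa-1)}-H_{2^{p-1}a}\big)\\ &-\gamma_1(2^{p-2}a+1)+2\gamma_1(2^{p-1}a+1)-2\gamma_1\big(\tfrac12(2^pa+1)\big)+\gamma_1\big(\tfrac14(2^pa+2)\big)\Big)\\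 =\frac14\Big(&-8\gamma_1\big(\tfrac12(2^na+1)\big)+8\log(i2^{-n})\,\psi^{(0)}\big(\tfrac12(2^na+1)\big)+8\gamma_1\big(\tfrac{a+2}4\big)\\ &+(-8\log 2-4i\pi)\,\psi^{(0)}\big(\tfrac{a+2}4\big)+4\log^2(i2^{-n})+(\pi-2i\log 2)^2\Big). \end{aligned}$$ -/

import Mathlib

namespace StieltjesSum

/-- `Z` is the Hurwitz zeta function `s ↦ ζ(s, v)` on the half-plane `Re s > 0` punctured at
`s = 1`: the analytic continuation of `∑ (n + v)^(-s)`, `Re s > 1` (principal powers).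
The domain is connected, so `Z` is unique on it; it contains a punctured neighbourhood of the
pole `s = 1`, which is all that the Laurent coefficients there depend on. -/
def IsHurwitzZeta (v : ℂ) (Z : ℂ → ℂ) : Prop :=
  DifferentiableOn ℂ Z {s : ℂ | 0 < s.re ∧ s ≠ 1} ∧
    ∀ s : ℂ, 1 < s.re → HasSum (fun n : ℕ => ((n : ℂ) + v) ^ (-s)) (Z s)

/-- The Hurwitz zeta function `ζ(s, v)` for `Re s > 0`, `s ≠ 1`, `v ≠ 0, -1, -2, …`. -/
noncomputable def hurwitzZeta (v : ℂ) : ℂ → ℂ :=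
  Classical.epsilon (IsHurwitzZeta v)

/-- `c` is the sequence of generalized Stieltjes constants at `v`, i.e. near `s = 1`
`ζ(s, v) = 1 / (s - 1) + ∑ₖ (-1)^k / k! * c k * (s - 1)^k`. -/
def IsStieltjesSeq (v : ℂ) (c : ℕ → ℂ) : Prop :=
  ∃ r : ℝ, 0 < r ∧ ∀ s : ℂ, s ≠ 1 → ‖s - 1‖ < r →
    HasSum (fun k : ℕ => (-1) ^ k / (Nat.factorial k : ℂ) * c k * (s - 1) ^ k)
      (hurwitzZeta v s - 1 / (s - 1))

/-- The generalized Stieltjes constant `γ_k(v)`. -/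
noncomputable def stieltjes (k : ℕ) (v : ℂ) : ℂ :=
  Classical.epsilon (IsStieltjesSeq v) k

/-- The harmonic number `H_z = ψ(z + 1) + γ` of complex index. -/
noncomputable def harmonicNumber (z : ℂ) : ℂ :=
  Complex.digamma (z + 1) + (Real.eulerMascheroniConstant : ℂ)

end StieltjesSum

/-!
Splitting the Dirichlet series into residue classes modulo `m` gives
`∑ⱼ ζ(s, v + j / m) = m ^ s * ζ(s, m v)`, and the Laurent coefficients of both sides at `s = 1`
give multiplication formulas for all Stieltjes constants. The case `m = 2` eliminates the values
at `w + 1 / 2` and `2 w`, `w = (2 ^ p a + 2) / 4`, from the `p`-th summand of the theorem, and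
what remains is the difference between the indices `p + 1` and `p` of twice the coefficient of
`s - 1` in `(i 2 ^ (1 - p)) ^ (1 - s) * ζ(s, w)`; so the sum telescopes.

The digamma function enters as `-γ₀`: by the functional equation of `Γ`, the partial sums of
`ζ(s, v) - ζ(s)` at `s = 1` are values of `ψ`, and log-convexity of `Γ` controls `ψ` at infinity.
-/

namespace StieltjesSum

open Filter Topology Set Finset

lemma norm_cpow_le_rpow_mul_exp (z s : ℂ) :
    ‖z ^ s‖ ≤ ‖z‖ ^ s.re * Real.exp (Real.pi * |s.im|) := by
  refine (Complex.norm_cpow_le z s).trans ?_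
  rw [div_eq_mul_inv, ← Real.exp_neg]
  gcongr
  calc -(z.arg * s.im) ≤ |z.arg| * |s.im| := (neg_le_abs _).trans (abs_mul _ _).le
    _ ≤ Real.pi * |s.im| := by gcongr; exact Complex.abs_arg_le_pi z

lemma norm_cpow_neg_sub_cpow_neg_le {c : ℝ} (hc : 0 < c) {z w s : ℂ} (hz : c ≤ z.re)
    (hw : c ≤ w.re) (hs : 0 ≤ s.re) :
    ‖z ^ (-s) - w ^ (-s)‖ ≤
      ‖s‖ * (c ^ (-1 - s.re) * Real.exp (Real.pi * |s.im|)) * ‖z - w‖ := by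
  refine (convex_halfSpace_re_ge c).norm_image_sub_le_of_norm_hasDerivWithin_le
    (f := fun x : ℂ => x ^ (-s)) (f' := fun x : ℂ => -s * x ^ (-s - 1))
    (fun x (hx : c ≤ x.re) => ?_) (fun x (hx : c ≤ x.re) => ?_) hw hz
  · have hslit : x ∈ Complex.slitPlane := Or.inl (hc.trans_le hx)
    simpa using ((hasDerivAt_id x).cpow_const (c := -s) hslit).hasDerivWithinAt
  · have hre : (-s - 1).re = -1 - s.re := by simp; ring
    have him : |(-s - 1).im| = |s.im| := by simp
    have hpow : ‖x‖ ^ (-1 - s.re) ≤ c ^ (-1 - s.re) :=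
      Real.rpow_le_rpow_of_nonpos hc (hx.trans (Complex.re_le_norm x)) (by linarith)
    rw [norm_mul, norm_neg]
    gcongr
    refine (norm_cpow_le_rpow_mul_exp x (-s - 1)).trans ?_
    rw [hre, him]
    gcongr

/-- The `n`-th term of the Dirichlet series of `ζ(s, v) - ζ(s)`; the series of these differences
converges on the larger half-plane `0 < Re s`. -/
noncomputable def zetaDiffTerm (v s : ℂ) (n : ℕ) : ℂ :=
  ((n : ℂ) + v) ^ (-s) - ((n : ℂ) + 1) ^ (-s)

lemma norm_zetaDiffTerm_le {R M δ : ℝ} {v s : ℂ} {n : ℕ} (hR : 1 ≤ R) (hn : 2 * R ≤ n)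
    (hv : ‖v‖ ≤ R) (hM : ‖s‖ ≤ M) (hδ : 0 ≤ δ) (hs : δ ≤ s.re) :
    ‖zetaDiffTerm v s n‖ ≤
      M * Real.exp (Real.pi * M) * (R + 1) * ((n : ℝ) / 2) ^ (-1 - δ) := by
  have hv_re : -R ≤ v.re := (neg_le_neg hv).trans (neg_le_of_abs_le (Complex.abs_re_le_norm v))
  have hz : (n : ℝ) / 2 ≤ ((n : ℂ) + v).re := by
    rw [Complex.add_re, Complex.natCast_re]; linarith
  have hw : (n : ℝ) / 2 ≤ ((n : ℂ) + 1).re := by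
    rw [Complex.add_re, Complex.natCast_re, Complex.one_re]; linarith
  have him : |s.im| ≤ M := (Complex.abs_im_le_norm s).trans hM
  have hzw : ‖(n : ℂ) + v - (n + 1)‖ ≤ R + 1 := by
    rw [add_sub_add_left_eq_sub]
    exact (norm_sub_le v 1).trans (by simpa using hv)
  calc ‖zetaDiffTerm v s n‖
      ≤ ‖s‖ * (((n : ℝ) / 2) ^ (-1 - s.re) * Real.exp (Real.pi * |s.im|)) *
          ‖(n : ℂ) + v - (n + 1)‖ :=
        norm_cpow_neg_sub_cpow_neg_le (by linarith) hz hw (hδ.trans hs)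
    _ ≤ M * (((n : ℝ) / 2) ^ (-1 - δ) * Real.exp (Real.pi * M)) * (R + 1) := by
        have := (norm_nonneg s).trans hM
        gcongr
        linarith
    _ = _ := by ring

lemma exists_summable_norm_zetaDiffTerm_le (R M : ℝ) {δ : ℝ} (hδ : 0 < δ) :
    ∃ u : ℕ → ℝ, Summable u ∧ ∀ᶠ n in cofinite, ∀ v s : ℂ, ‖v‖ ≤ R → ‖s‖ ≤ M → δ ≤ s.re →
      ‖zetaDiffTerm v s n‖ ≤ u n := by
  refine ⟨fun n => M * Real.exp (Real.pi * M) * (max R 1 + 1) * ((n : ℝ) / 2) ^ (-1 - δ),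
    Summable.mul_left _ ?_, ?_⟩
  · have hsum := (Real.summable_nat_rpow.2 (by linarith : -1 - δ < -1)).div_const (2 ^ (-1 - δ))
    exact hsum.congr fun n => (Real.div_rpow n.cast_nonneg zero_le_two _).symm
  · rw [Nat.cofinite_eq_atTop]
    filter_upwards [eventually_ge_atTop ⌈2 * max R 1⌉₊] with n hn v s hv hM hs
    exact norm_zetaDiffTerm_le (le_max_right R 1) (Nat.ceil_le.1 hn) (hv.trans (le_max_left R 1))
      hM hδ.le hs

lemma summable_zetaDiffTerm (v : ℂ) {s : ℂ} (hs : 0 < s.re) : Summable (zetaDiffTerm v s) := by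
  obtain ⟨u, hu, hbound⟩ := exists_summable_norm_zetaDiffTerm_le ‖v‖ ‖s‖ hs
  exact Summable.of_norm_bounded_eventually hu
    (hbound.mono fun n hn => hn v s le_rfl le_rfl le_rfl)

lemma isOpen_re_pos : IsOpen {s : ℂ | 0 < s.re} :=
  isOpen_lt continuous_const Complex.continuous_re

lemma differentiableOn_tsum_zetaDiffTerm (v : ℂ) :
    DifferentiableOn ℂ (fun s => ∑' n, zetaDiffTerm v s n) {s | 0 < s.re} := by
  refine SummableLocallyUniformlyOn.differentiableOn isOpen_re_pos
    (.of_locally_bounded_eventually isOpen_re_pos fun K hK hKc => ?_) fun n s hs => ?_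
  · rcases K.eq_empty_or_nonempty with rfl | hne
    · exact ⟨0, summable_zero, by simp⟩
    obtain ⟨s₀, hs₀, hmin⟩ := hKc.exists_isMinOn hne Complex.continuous_re.continuousOn
    obtain ⟨M, hM⟩ := hKc.isBounded.exists_norm_le
    obtain ⟨u, hu, hbound⟩ := exists_summable_norm_zetaDiffTerm_le ‖v‖ M (hK hs₀)
    exact ⟨u, hu, hbound.mono fun n hn s hs => hn v s le_rfl (hM s hs) (hmin hs)⟩
  · have hs0 : -s ≠ 0 := neg_ne_zero.2 (Complex.ne_zero_of_re_pos hs)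
    exact (differentiableAt_id.neg.const_cpow (Or.inr hs0)).sub
      (differentiableAt_id.neg.const_cpow (Or.inr hs0))

lemma isOpen_ne_neg_nat : IsOpen {v : ℂ | ∀ m : ℕ, v ≠ -m} := by
  have h : {v : ℂ | ∀ m : ℕ, v ≠ -m} = {v : ℂ | (Complex.Gamma v)⁻¹ ≠ 0} := by
    ext v
    simp [Complex.Gamma_eq_zero_iff]
  rw [h]
  exact isOpen_ne_fun Complex.differentiable_one_div_Gamma.continuous continuous_const

lemma differentiableOn_tsum_zetaDiffTerm_one :
    DifferentiableOn ℂ (fun v => ∑' n, zetaDiffTerm v 1 n) {v | ∀ m : ℕ, v ≠ -m} := by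
  refine SummableLocallyUniformlyOn.differentiableOn isOpen_ne_neg_nat
    (.of_locally_bounded_eventually isOpen_ne_neg_nat fun K _ hKc => ?_) fun n v hv => ?_
  · obtain ⟨R, hR⟩ := hKc.isBounded.exists_norm_le
    obtain ⟨u, hu, hbound⟩ := exists_summable_norm_zetaDiffTerm_le R 1 one_pos
    exact ⟨u, hu, hbound.mono fun n hn v hv => hn v 1 (hR v hv) (by simp) (by simp)⟩
  · have hne : (n : ℂ) + v ≠ 0 := fun h => hv n (eq_neg_of_add_eq_zero_right h)
    simp only [zetaDiffTerm, Complex.cpow_neg_one]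
    fun_prop (disch := exact hne)

/-- The regular part `ζ(s, v) - 1 / (s - 1)` of the Hurwitz zeta function on `0 < Re s`, as the
counterpart of `riemannZeta₀`. -/
noncomputable def hurwitzZeta₀ (v s : ℂ) : ℂ := riemannZeta₀ s + ∑' n, zetaDiffTerm v s n

lemma differentiableOn_hurwitzZeta₀ (v : ℂ) :
    DifferentiableOn ℂ (hurwitzZeta₀ v) {s | 0 < s.re} :=
  differentiable_riemannZeta₀.differentiableOn.add (differentiableOn_tsum_zetaDiffTerm v)

lemma analyticAt_hurwitzZeta₀_one (v : ℂ) : AnalyticAt ℂ (hurwitzZeta₀ v) 1 :=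
  (differentiableOn_hurwitzZeta₀ v).analyticAt (isOpen_re_pos.mem_nhds (by simp))

lemma hasSum_hurwitzZeta₀ (v : ℂ) {s : ℂ} (hs : 1 < s.re) :
    HasSum (fun n : ℕ => ((n : ℂ) + v) ^ (-s)) (1 / (s - 1) + hurwitzZeta₀ v s) := by
  have hs1 : s ≠ 1 := by rintro rfl; simp at hs
  have hzeta : HasSum (fun n : ℕ => ((n : ℂ) + 1) ^ (-s)) (riemannZeta s) := by
    have hsum := (summable_nat_add_iff 1).2 (Complex.summable_one_div_nat_cpow.2 hs)
    rw [zeta_eq_tsum_one_div_nat_add_one_cpow hs]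
    simpa [Complex.cpow_neg] using hsum.hasSum
  convert! hzeta.add (summable_zetaDiffTerm v (zero_lt_one.trans hs)).hasSum using 1
  · simp [zetaDiffTerm]
  · rw [riemannZeta_eq_inv_sub_add hs1, hurwitzZeta₀, one_div, add_assoc]

lemma isHurwitzZeta_hurwitzZeta₀ (v : ℂ) :
    IsHurwitzZeta v (fun s => 1 / (s - 1) + hurwitzZeta₀ v s) := by
  refine ⟨DifferentiableOn.add (fun s hs => ?_) ((differentiableOn_hurwitzZeta₀ v).mono
    fun s hs => hs.1), fun s hs => hasSum_hurwitzZeta₀ v hs⟩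
  have hs1 : s - 1 ≠ 0 := sub_ne_zero.2 hs.2
  fun_prop (disch := exact hs1)

lemma isHurwitzZeta_hurwitzZeta (v : ℂ) : IsHurwitzZeta v (hurwitzZeta v) :=
  Classical.epsilon_spec ⟨_, isHurwitzZeta_hurwitzZeta₀ v⟩

lemma isPreconnected_re_pos_ne_one : IsPreconnected {s : ℂ | 0 < s.re ∧ s ≠ 1} := by
  -- The half-plane is homeomorphic to `ℂ` via `x + i y ↦ log x + i y`, which takes `1` to `0`.
  have h := (isConnected_compl_singleton_of_one_lt_rank (E := ℂ) (by simp) 0).isPreconnected.image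
    (fun w : ℂ => (Real.exp w.re : ℂ) + w.im * Complex.I) (by fun_prop)
  convert h using 1
  ext s
  constructor
  · rintro ⟨hpos, hne⟩
    refine ⟨⟨Real.log s.re, s.im⟩, fun h0 => hne ?_, ?_⟩
    · obtain ⟨hre, him⟩ := Complex.ext_iff.1 (mem_singleton_iff.1 h0)
      exact Complex.ext (Real.eq_one_of_pos_of_log_eq_zero hpos hre) him
    · simp [Real.exp_log hpos]
  · rintro ⟨w, hw, rfl⟩
    simpa [-Complex.ofReal_exp, Complex.ext_iff, Real.exp_pos] using hw

lemma IsHurwitzZeta.eqOn {v : ℂ} {Z W : ℂ → ℂ} (hZ : IsHurwitzZeta v Z)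
    (hW : IsHurwitzZeta v W) : EqOn Z W {s : ℂ | 0 < s.re ∧ s ≠ 1} := by
  have hopen : IsOpen {s : ℂ | 0 < s.re ∧ s ≠ 1} := isOpen_re_pos.inter isOpen_ne
  refine (hZ.1.analyticOnNhd hopen).eqOn_of_preconnected_of_eventuallyEq
    (hW.1.analyticOnNhd hopen) isPreconnected_re_pos_ne_one (z₀ := 2) (by simp) ?_
  filter_upwards [Complex.continuous_re.continuousAt.eventually_const_lt
    (show 1 < (2 : ℂ).re by simp)] with s hs
  exact (hZ.2 s hs).unique (hW.2 s hs)

lemma hurwitzZeta_eq (v : ℂ) {s : ℂ} (hs : 0 < s.re) (hs1 : s ≠ 1) :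
    hurwitzZeta v s = 1 / (s - 1) + hurwitzZeta₀ v s :=
  (isHurwitzZeta_hurwitzZeta v).eqOn (isHurwitzZeta_hurwitzZeta₀ v) ⟨hs, hs1⟩

lemma re_pos_of_norm_sub_one_lt {s : ℂ} (hs : ‖s - 1‖ < 1) : 0 < s.re := by
  have h := (abs_lt.1 ((Complex.abs_re_le_norm (s - 1)).trans_lt hs)).1
  rw [Complex.sub_re, Complex.one_re] at h
  linarith

lemma exists_isStieltjesSeq (v : ℂ) : ∃ c, IsStieltjesSeq v c := by
  refine ⟨fun k => (-1) ^ k * iteratedDeriv k (hurwitzZeta₀ v) 1, 1, one_pos,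
    fun s hs1 hs => ?_⟩
  have hd : DifferentiableOn ℂ (hurwitzZeta₀ v) (Metric.ball 1 1) :=
    (differentiableOn_hurwitzZeta₀ v).mono fun z hz =>
      re_pos_of_norm_sub_one_lt (mem_ball_iff_norm.1 hz)
  have htaylor := Complex.hasSum_taylorSeries_on_ball hd (mem_ball_iff_norm.2 hs)
  rw [hurwitzZeta_eq v (re_pos_of_norm_sub_one_lt hs) hs1, add_sub_cancel_left]
  convert! htaylor using 2 with k
  have hsign : (-1 : ℂ) ^ k * (-1) ^ k = 1 := pow_mul_pow_eq_one k (by norm_num)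
  rw [smul_eq_mul, smul_eq_mul]
  linear_combination (k.factorial : ℂ)⁻¹ * iteratedDeriv k (hurwitzZeta₀ v) 1 * (s - 1) ^ k * hsign

lemma coeff_eq_iteratedDeriv_of_hasSum {f : ℂ → ℂ} {z₀ : ℂ} (hf : AnalyticAt ℂ f z₀) {b : ℕ → ℂ}
    (hb : ∀ᶠ z in 𝓝[≠] z₀, HasSum (fun k => b k * (z - z₀) ^ k) (f z)) (k : ℕ) :
    b k = iteratedDeriv k f z₀ / k.factorial := by
  let G : ℂ → ℂ := fun z => ∑' k, b k * (z - z₀) ^ k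
  have hGf : G =ᶠ[𝓝[≠] z₀] f := hb.mono fun _ h => h.tsum_eq
  have hG : HasFPowerSeriesAt G (FormalMultilinearSeries.ofScalars ℂ b) z₀ := by
    rw [hasFPowerSeriesAt_iff']
    filter_upwards [eventually_nhdsWithin_iff.1 hb] with z hz
    have hsummable : Summable fun k => b k * (z - z₀) ^ k := by
      rcases eq_or_ne z z₀ with rfl | hne
      · exact (hasSum_single 0 fun k hk => by simp [hk]).summable
      · exact (hz hne).summable
    simpa only [FormalMultilinearSeries.coeff_ofScalars, smul_eq_mul, mul_comm]
      using hsummable.hasSum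
  have hfps := hG.congr
    ((hG.continuousAt.eventuallyEq_nhds_iff_eventuallyEq_nhdsNE hf.continuousAt).1 hGf)
  simpa only [FormalMultilinearSeries.coeff_ofScalars] using
    congrArg (fun p => p.coeff k) (hfps.eq_formalMultilinearSeries hf.hasFPowerSeriesAt)

lemma IsStieltjesSeq.eq_iteratedDeriv {v : ℂ} {c : ℕ → ℂ} (hc : IsStieltjesSeq v c) (k : ℕ) :
    c k = (-1) ^ k * iteratedDeriv k (hurwitzZeta₀ v) 1 := by
  obtain ⟨r, hr, hsum⟩ := hc
  have hcoeff := coeff_eq_iteratedDeriv_of_hasSum (analyticAt_hurwitzZeta₀_one v)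
    (b := fun k => (-1) ^ k / (k.factorial : ℂ) * c k) ?_ k
  · have hfac : (k.factorial : ℂ) ≠ 0 := Nat.cast_ne_zero.2 k.factorial_ne_zero
    have hsign : (-1 : ℂ) ^ k * (-1) ^ k = 1 := pow_mul_pow_eq_one k (by norm_num)
    field_simp at hcoeff
    linear_combination (-1) ^ k * hcoeff - c k * hsign
  · filter_upwards [self_mem_nhdsWithin,
      nhdsWithin_le_nhds (Metric.ball_mem_nhds (1 : ℂ) (lt_min hr one_pos))] with s hs1 hs
    obtain ⟨hsr, hs_one⟩ := lt_min_iff.1 (mem_ball_iff_norm.1 hs)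
    simpa only [hurwitzZeta_eq v (re_pos_of_norm_sub_one_lt hs_one) hs1, add_sub_cancel_left]
      using hsum s hs1 hsr

lemma stieltjes_eq_iteratedDeriv (k : ℕ) (v : ℂ) :
    stieltjes k v = (-1) ^ k * iteratedDeriv k (hurwitzZeta₀ v) 1 :=
  (Classical.epsilon_spec (exists_isStieltjesSeq v)).eq_iteratedDeriv k

lemma differentiableAt_realGamma_of_pos {x : ℝ} (hx : 0 < x) : DifferentiableAt ℝ Real.Gamma x :=
  Real.differentiableAt_Gamma fun m => ((neg_nonpos.2 m.cast_nonneg).trans_lt hx).ne'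

lemma ofReal_ne_neg_natCast {x : ℝ} (hx : 0 < x) (m : ℕ) : (x : ℂ) ≠ -m := by
  exact_mod_cast ((neg_nonpos.2 m.cast_nonneg).trans_lt hx).ne'

lemma digamma_ofReal {x : ℝ} (hx : 0 < x) :
    Complex.digamma x = (logDeriv Real.Gamma x : ℝ) := by
  have hcomplex :=
    (Complex.differentiableAt_Gamma x (ofReal_ne_neg_natCast hx)).hasDerivAt.comp_ofReal
  have hreal := (differentiableAt_realGamma_of_pos hx).hasDerivAt.ofReal_comp
  simp only [Complex.Gamma_ofReal] at hcomplex
  rw [Complex.digamma_def, logDeriv_apply, logDeriv_apply, hcomplex.unique hreal,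
    Complex.Gamma_ofReal, Complex.ofReal_div]

lemma slope_log_Gamma_add_one {x : ℝ} (hx : 0 < x) :
    slope (Real.log ∘ Real.Gamma) x (x + 1) = Real.log x := by
  simp [slope_def_field, Real.Gamma_add_one hx.ne',
    Real.log_mul hx.ne' (Real.Gamma_pos_of_pos hx).ne']

lemma log_le_logDeriv_Gamma_add_one {x : ℝ} (hx : 0 < x) :
    Real.log x ≤ logDeriv Real.Gamma (x + 1) := by
  have hx1 : 0 < x + 1 := by linarith
  have hd := differentiableAt_realGamma_of_pos hx1
  have hne := (Real.Gamma_pos_of_pos hx1).ne'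
  rw [← slope_log_Gamma_add_one hx, ← Real.deriv_log_comp_eq_logDeriv hd hne]
  exact Real.convexOn_log_Gamma.slope_le_deriv hx hx1 (lt_add_one x) (hd.log hne)

lemma logDeriv_Gamma_le_log {x : ℝ} (hx : 0 < x) : logDeriv Real.Gamma x ≤ Real.log x := by
  have hd := differentiableAt_realGamma_of_pos hx
  have hne := (Real.Gamma_pos_of_pos hx).ne'
  rw [← slope_log_Gamma_add_one hx, ← Real.deriv_log_comp_eq_logDeriv hd hne]
  exact Real.convexOn_log_Gamma.deriv_le_slope hx (hx.trans (lt_add_one x)) (lt_add_one x)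
    (hd.log hne)

lemma tendsto_logDeriv_Gamma_add_nat_sub_log {x : ℝ} (hx : 0 < x) :
    Tendsto (fun n : ℕ => logDeriv Real.Gamma (n + x) - Real.log n) atTop (𝓝 0) := by
  have hlim (y : ℝ) : Tendsto (fun n : ℕ => Real.log (n + y) - Real.log n) atTop (𝓝 0) :=
    (Real.tendsto_log_comp_add_sub_log y).comp tendsto_natCast_atTop_atTop
  refine tendsto_of_tendsto_of_tendsto_of_le_of_le' (hlim (x - 1)) (hlim x) ?_ ?_
  · filter_upwards [eventually_ge_atTop 1] with n hn
    have hn' : (1 : ℝ) ≤ n := by exact_mod_cast hn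
    have hle := log_le_logDeriv_Gamma_add_one (x := n + (x - 1)) (by linarith)
    rw [add_assoc, sub_add_cancel] at hle
    linarith
  · filter_upwards with n
    linarith [logDeriv_Gamma_le_log (x := n + x) (by positivity)]

lemma sum_range_zetaDiffTerm_one {v : ℂ} (hv : ∀ m : ℕ, v ≠ -m) (n : ℕ) :
    ∑ k ∈ range n, zetaDiffTerm v 1 k =
      Complex.digamma (n + v) - Complex.digamma v - (harmonic n : ℚ) := by
  induction n with
  | zero => simp
  | succ n ih =>
    have hnv (m : ℕ) : (n : ℂ) + v ≠ -m := fun h => hv (n + m) (by push_cast; linear_combination h)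
    rw [sum_range_succ, ih, harmonic_succ, Nat.cast_succ, add_right_comm,
      Complex.digamma_apply_add_one _ hnv, zetaDiffTerm]
    simp only [Complex.cpow_neg_one]
    push_cast
    ring

lemma digamma_ofReal_eq_neg_hurwitzZeta₀_one {x : ℝ} (hx : 0 < x) :
    Complex.digamma x = -hurwitzZeta₀ x 1 := by
  have hsum := (summable_zetaDiffTerm (x : ℂ) (s := 1) (by simp)).hasSum.tendsto_sum_nat
  have hlim : Tendsto (fun n : ℕ => logDeriv Real.Gamma (n + x) - logDeriv Real.Gamma x
      - (harmonic n : ℝ)) atTop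
      (𝓝 (0 - Real.eulerMascheroniConstant - logDeriv Real.Gamma x)) :=
    (((tendsto_logDeriv_Gamma_add_nat_sub_log hx).sub Real.tendsto_harmonic_sub_log).sub_const
      (logDeriv Real.Gamma x)).congr fun n => by ring
  have hpartial (n : ℕ) : ∑ k ∈ range n, zetaDiffTerm x 1 k =
      (logDeriv Real.Gamma (n + x) - logDeriv Real.Gamma x - (harmonic n : ℝ) : ℝ) := by
    have hnx := digamma_ofReal (x := n + x) (by positivity)
    rw [Complex.ofReal_add, Complex.ofReal_natCast] at hnx
    rw [sum_range_zetaDiffTerm_one (ofReal_ne_neg_natCast hx), hnx, digamma_ofReal hx]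
    push_cast
    rfl
  have htsum := tendsto_nhds_unique hsum
    (((Complex.continuous_ofReal.tendsto _).comp hlim).congr fun n => (hpartial n).symm)
  rw [hurwitzZeta₀, riemannZeta₀_one, htsum, digamma_ofReal hx]
  push_cast
  ring

lemma isPreconnected_ne_neg_nat : IsPreconnected {v : ℂ | ∀ m : ℕ, v ≠ -m} := by
  have h := ((countable_range fun m : ℕ => -(m : ℂ)).isConnected_compl_of_one_lt_rank
    (by simp)).isPreconnected
  convert h using 1
  ext z
  simp [eq_comm]

lemma digamma_eq_neg_hurwitzZeta₀_one {v : ℂ} (hv : ∀ m : ℕ, v ≠ -m) :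
    Complex.digamma v = -hurwitzZeta₀ v 1 := by
  have hGamma : DifferentiableOn ℂ Complex.Gamma {v : ℂ | ∀ m : ℕ, v ≠ -m} := fun z hz =>
    (Complex.differentiableAt_Gamma z hz).differentiableWithinAt
  have hdigamma : DifferentiableOn ℂ Complex.digamma {v : ℂ | ∀ m : ℕ, v ≠ -m} :=
    (hGamma.deriv isOpen_ne_neg_nat).div hGamma fun z hz => Complex.Gamma_ne_zero hz
  have hzeta : DifferentiableOn ℂ (fun v => -hurwitzZeta₀ v 1) {v : ℂ | ∀ m : ℕ, v ≠ -m} :=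
    (differentiableOn_tsum_zetaDiffTerm_one.const_add _).neg
  have htendsto : Tendsto (fun x : ℝ => (x : ℂ)) (𝓝[≠] 1) (𝓝[≠] 1) := by
    simpa only [Complex.ofReal_one] using
      Complex.continuous_ofReal.continuousAt.continuousWithinAt.tendsto_nhdsWithin (x := 1)
        (s := {1}ᶜ) (t := {1}ᶜ) fun x hx => by simpa using hx
  refine (hdigamma.analyticOnNhd isOpen_ne_neg_nat).eqOn_of_preconnected_of_frequently_eq
    (hzeta.analyticOnNhd isOpen_ne_neg_nat) isPreconnected_ne_neg_nat
    (by simpa using ofReal_ne_neg_natCast one_pos) (htendsto.frequently ?_) hv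
  refine Eventually.frequently ?_
  filter_upwards [nhdsWithin_le_nhds (lt_mem_nhds one_pos)] with x hx
    using digamma_ofReal_eq_neg_hurwitzZeta₀_one hx

lemma stieltjes_zero_eq_neg_digamma {v : ℂ} (hv : ∀ m : ℕ, v ≠ -m) :
    stieltjes 0 v = -Complex.digamma v := by
  rw [stieltjes_eq_iteratedDeriv, digamma_eq_neg_hurwitzZeta₀_one hv]
  simp

lemma ofReal_mul_cpow {r : ℝ} (hr : 0 < r) (z s : ℂ) :
    ((r : ℂ) * z) ^ s = (r : ℂ) ^ s * z ^ s := by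
  have hr0 : (r : ℂ) ≠ 0 := Complex.ofReal_ne_zero.2 hr.ne'
  rcases eq_or_ne z 0 with rfl | hz
  · rcases eq_or_ne s 0 with rfl | hs <;> simp [*]
  · rw [Complex.cpow_def_of_ne_zero (mul_ne_zero hr0 hz), Complex.cpow_def_of_ne_zero hr0,
      Complex.cpow_def_of_ne_zero hz, Complex.log_ofReal_mul hr hz, Complex.ofReal_log hr.le,
      add_mul, Complex.exp_add]

lemma hasSum_of_hasSum_residueClasses {R : Type*} [AddCommGroup R] [UniformSpace R]
    [IsUniformAddGroup R] [CompleteSpace R] [T2Space R] {f : ℕ → R} (hf : Summable f)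
    {m : ℕ} [NeZero m] {g : ℕ → R} (hg : ∀ j, HasSum (fun k => f (j + m * k)) (g j)) :
    HasSum f (∑ j ∈ range m, g j) := by
  have hval : ∑ j : ZMod m, g j.val = ∑ j ∈ range m, g j := by
    obtain ⟨m, rfl⟩ := Nat.exists_eq_succ_of_ne_zero (NeZero.ne m)
    exact Fin.sum_univ_eq_sum_range g (m + 1)
  rw [← hval, ← sum_congr rfl fun j _ => (hg j.val).tsum_eq, ← Nat.sumByResidueClasses hf m]
  exact hf.hasSum

lemma iteratedDeriv_const_cpow {c : ℂ} (hc : c ≠ 0) (n : ℕ) (s : ℂ) :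
    iteratedDeriv n (fun s => c ^ s) s = Complex.log c ^ n * c ^ s := by
  simp only [Complex.cpow_def_of_ne_zero hc, iteratedDeriv_cexp_const_mul]

lemma iteratedDeriv_succ_sub_mul {h : ℂ → ℂ} {a : ℂ} (hh : AnalyticAt ℂ h a) (k : ℕ) :
    iteratedDeriv (k + 1) (fun s => (s - a) * h s) a = (k + 1) * iteratedDeriv k h a := by
  rw [iteratedDeriv_fun_mul (by fun_prop) hh.contDiffAt, sum_eq_single 1]
  · simp
  · rintro (_ | _ | i) _ hi
    · simp
    · exact absurd rfl hi
    · simp [iteratedDeriv_succ', iteratedDeriv_const]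
  · simp

section Multiplication

variable (m : ℕ) [NeZero m] (v : ℂ)

lemma isHurwitzZeta_natCast_mul :
    IsHurwitzZeta (m * v) fun s => (m : ℂ) ^ (-s) * ∑ j ∈ range m, hurwitzZeta (v + j / m) s := by
  have hm : (m : ℂ) ≠ 0 := NeZero.ne _
  refine ⟨?_, fun s hs => ?_⟩
  · exact (differentiable_neg.const_cpow (Or.inl hm)).differentiableOn.mul
      (.fun_sum fun j _ => (isHurwitzZeta_hurwitzZeta (v + j / m)).1)
  · have hsummable := ((isHurwitzZeta_hurwitzZeta (m * v)).2 s hs).summable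
    beta_reduce
    rw [mul_sum]
    refine hasSum_of_hasSum_residueClasses hsummable fun j => ?_
    refine (((isHurwitzZeta_hurwitzZeta (v + j / m)).2 s hs).mul_left _).congr_fun fun k => ?_
    have hbase : ((j + m * k : ℕ) : ℂ) + m * v = (m : ℝ) * (k + (v + j / m)) := by
      push_cast
      field_simp
      ring
    rw [hbase, ofReal_mul_cpow (Nat.cast_pos.2 (NeZero.pos m)), Complex.ofReal_natCast]

lemma sum_hurwitzZeta_add_div {s : ℂ} (hs : 0 < s.re) (hs1 : s ≠ 1) :
    ∑ j ∈ range m, hurwitzZeta (v + j / m) s = (m : ℂ) ^ s * hurwitzZeta (m * v) s := by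
  have hpow : (m : ℂ) ^ s ≠ 0 := by simp [Complex.cpow_eq_zero_iff, NeZero.ne m]
  have heq := (isHurwitzZeta_hurwitzZeta (m * v)).eqOn (isHurwitzZeta_natCast_mul m v) ⟨hs, hs1⟩
  rw [heq, Complex.cpow_neg, mul_inv_cancel_left₀ hpow]

lemma sub_one_mul_sum_hurwitzZeta₀_add_div {s : ℂ} (hs : 0 < s.re) :
    (s - 1) * (∑ j ∈ range m, hurwitzZeta₀ (v + j / m) s - (m : ℂ) ^ s * hurwitzZeta₀ (m * v) s) =
      (m : ℂ) ^ s - m := by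
  rcases eq_or_ne s 1 with rfl | hs1
  · simp
  have hmul := sum_hurwitzZeta_add_div m v hs hs1
  simp only [hurwitzZeta_eq _ hs hs1, sum_add_distrib, sum_const, card_range, nsmul_eq_mul] at hmul
  have hpole : (s - 1) * (1 / (s - 1)) = 1 := mul_one_div_cancel (sub_ne_zero.2 hs1)
  linear_combination (s - 1) * hmul - (m - (m : ℂ) ^ s) * hpole

lemma sum_iteratedDeriv_hurwitzZeta₀_add_div (k : ℕ) :
    ∑ j ∈ range m, iteratedDeriv k (hurwitzZeta₀ (v + j / m)) 1 =
      m * ∑ i ∈ range (k + 1),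
        k.choose i * Complex.log m ^ i * iteratedDeriv (k - i) (hurwitzZeta₀ (m * v)) 1
      + m * Complex.log m ^ (k + 1) / (k + 1) := by
  have hm : (m : ℂ) ≠ 0 := NeZero.ne _
  have hpow : AnalyticAt ℂ (fun s : ℂ => (m : ℂ) ^ s) 1 :=
    analyticAt_const.cpow analyticAt_id (by simp [Complex.mem_slitPlane_iff, NeZero.pos m])
  have hterm (j : ℕ) := analyticAt_hurwitzZeta₀_one (v + j / m)
  have hmv := analyticAt_hurwitzZeta₀_one (m * v)
  have hsum : AnalyticAt ℂ (fun s => ∑ j ∈ range m, hurwitzZeta₀ (v + j / m) s) 1 :=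
    analyticAt_fun_sum _ fun j _ => hterm j
  have heq := EventuallyEq.iteratedDeriv_eq (k + 1) <|
    (isOpen_re_pos.eventually_mem (x := 1) (by simp)).mono fun s hs =>
      sub_one_mul_sum_hurwitzZeta₀_add_div m v hs
  rw [iteratedDeriv_succ_sub_mul (hsum.fun_sub (hpow.fun_mul hmv)),
    iteratedDeriv_fun_sub hsum.contDiffAt (hpow.fun_mul hmv).contDiffAt,
    iteratedDeriv_fun_sum fun j _ => (hterm j).contDiffAt,
    iteratedDeriv_fun_mul hpow.contDiffAt hmv.contDiffAt,
    iteratedDeriv_fun_sub hpow.contDiffAt contDiffAt_const] at heq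
  simp only [iteratedDeriv_const_cpow hm, iteratedDeriv_const, Nat.succ_ne_zero, if_false,
    Complex.cpow_one, sub_zero] at heq
  have hk : (k : ℂ) + 1 ≠ 0 := Nat.cast_add_one_ne_zero k
  rw [mul_sum, ← sub_eq_iff_eq_add', eq_div_iff hk, mul_comm, mul_comm (m : ℂ) (_ ^ _), ← heq]
  congr! 3
  ring

lemma sum_stieltjes_add_div (k : ℕ) :
    ∑ j ∈ range m, stieltjes k (v + j / m) =
      m * ∑ i ∈ range (k + 1), k.choose i * (-Complex.log m) ^ i * stieltjes (k - i) (m * v)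
      - m * (-Complex.log m) ^ (k + 1) / (k + 1) := by
  have hterm (i : ℕ) (hi : i ∈ range (k + 1)) :
      k.choose i * (-Complex.log m) ^ i * stieltjes (k - i) (m * v) = (-1) ^ k *
        (k.choose i * Complex.log m ^ i * iteratedDeriv (k - i) (hurwitzZeta₀ (m * v)) 1) := by
    obtain ⟨j, rfl⟩ := Nat.exists_eq_add_of_le (Nat.lt_succ_iff.1 (mem_range.1 hi))
    rw [stieltjes_eq_iteratedDeriv, Nat.add_sub_cancel_left, neg_pow (Complex.log m), pow_add]
    ring
  simp only [stieltjes_eq_iteratedDeriv k, ← mul_sum, sum_iteratedDeriv_hurwitzZeta₀_add_div]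
  rw [sum_congr rfl hterm, ← mul_sum, neg_pow (Complex.log m)]
  ring

end Multiplication

lemma digamma_add_digamma_add_half {v : ℂ} (hv : ∀ m : ℕ, 2 * v ≠ -m) :
    Complex.digamma v + Complex.digamma (v + 1 / 2) =
      2 * Complex.digamma (2 * v) - 2 * Complex.log 2 := by
  have hv₀ (m : ℕ) : v ≠ -m := fun h => hv (2 * m) (by rw [h]; push_cast; ring)
  have hv₁ (m : ℕ) : v + 1 / 2 ≠ -m := fun h =>
    hv (2 * m + 1) (by rw [eq_sub_of_add_eq h]; push_cast; ring)
  have h : stieltjes 0 v + stieltjes 0 (v + 1 / 2) =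
      2 * stieltjes 0 (2 * v) + 2 * Complex.log 2 := by
    simpa [sum_range_succ] using sum_stieltjes_add_div 2 v 0
  rw [stieltjes_zero_eq_neg_digamma hv₀, stieltjes_zero_eq_neg_digamma hv₁,
    stieltjes_zero_eq_neg_digamma hv] at h
  linear_combination -h

lemma stieltjes_one_add_stieltjes_one_add_half {v : ℂ} (hv : ∀ m : ℕ, 2 * v ≠ -m) :
    stieltjes 1 v + stieltjes 1 (v + 1 / 2) = 2 * stieltjes 1 (2 * v)
      + 2 * Complex.log 2 * Complex.digamma (2 * v) - Complex.log 2 ^ 2 := by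
  have h : stieltjes 1 v + stieltjes 1 (v + 1 / 2) =
      2 * (stieltjes 1 (2 * v) - Complex.log 2 * stieltjes 0 (2 * v)) - Complex.log 2 ^ 2 := by
    convert! sum_stieltjes_add_div 2 v 1 using 1 <;> norm_num [sum_range_succ, sub_eq_add_neg]
  rw [stieltjes_zero_eq_neg_digamma hv] at h
  linear_combination h

/-- Twice the coefficient of `s - 1` in the Laurent expansion of `exp (-ℓ (s - 1)) ζ(s, w)` at
`s = 1`, the digamma function standing for `-γ₀`. The sum of the main theorem telescopes along
`ℓ = log (i 2^(1-p))`, `w = (2^p a + 2) / 4`. -/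
noncomputable def stieltjesPotential (ℓ w : ℂ) : ℂ :=
  ℓ ^ 2 + 2 * ℓ * Complex.digamma w - 2 * stieltjes 1 w

lemma stieltjesPotential_sub (ℓ : ℂ) {x : ℂ} (hx : ∀ m : ℕ, x / 2 + 1 ≠ -m) :
    ℓ * (harmonicNumber (x / 4) - harmonicNumber (1 / 4 * (x - 2)))
        + 2 * (ℓ - Complex.log 2) * (harmonicNumber (1 / 2 * (x - 1)) - harmonicNumber (x / 2))
        - stieltjes 1 (x / 4 + 1) + 2 * stieltjes 1 (x / 2 + 1)
        - 2 * stieltjes 1 (1 / 2 * (x + 1)) + stieltjes 1 (1 / 4 * (x + 2)) =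
      stieltjesPotential (ℓ - Complex.log 2) (1 / 2 * (x + 1)) -
        stieltjesPotential ℓ (1 / 4 * (x + 2)) := by
  have hdouble : 2 * (1 / 4 * (x + 2)) = x / 2 + 1 := by ring
  have hhalf : 1 / 4 * (x + 2) + 1 / 2 = x / 4 + 1 := by ring
  have hsub_two : 1 / 4 * (x - 2) + 1 = 1 / 4 * (x + 2) := by ring
  have hsub_one : 1 / 2 * (x - 1) + 1 = 1 / 2 * (x + 1) := by ring
  rw [← hdouble] at hx
  have hdigamma := digamma_add_digamma_add_half hx
  have hstieltjes := stieltjes_one_add_stieltjes_one_add_half hx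
  rw [hdouble, hhalf] at hdigamma hstieltjes
  simp only [harmonicNumber, stieltjesPotential, hsub_two, hsub_one]
  linear_combination ℓ * hdigamma - hstieltjes

lemma log_I_mul_two_zpow (k : ℤ) :
    Complex.log (Complex.I * (2 : ℂ) ^ k) = k * Complex.log 2 + (Real.pi : ℂ) / 2 * Complex.I := by
  have h := Complex.log_ofReal_mul (r := (2 : ℝ) ^ k) (by positivity) Complex.I_ne_zero
  have hlog_two : ((Real.log 2 : ℝ) : ℂ) = Complex.log 2 := Complex.ofReal_log two_pos.le
  rw [Real.log_zpow, Complex.log_I] at h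
  push_cast [hlog_two] at h
  rwa [mul_comm]

lemma log_I_mul_two_zpow_neg (p : ℤ) :
    Complex.log (Complex.I * (2 : ℂ) ^ (-p)) =
      Complex.log (Complex.I * (2 : ℂ) ^ (1 - p)) - Complex.log 2 := by
  rw [log_I_mul_two_zpow, log_I_mul_two_zpow]
  push_cast
  ring

lemma two_pow_mul_div_two_add_one_ne_neg_natCast {n : ℕ} {a : ℂ}
    (ha : ∀ j : ℕ, 1 ≤ j → (2 : ℂ) ^ n * a ≠ -(j : ℂ)) {p : ℕ} (hp : p ≤ n) (m : ℕ) :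
    2 ^ p * a / 2 + 1 ≠ -(m : ℂ) := fun h => by
  obtain ⟨q, rfl⟩ := Nat.exists_eq_add_of_le hp
  refine ha (2 ^ q * (2 * (m + 1))) (Nat.mul_pos (by positivity) (by positivity)) ?_
  push_cast
  linear_combination 2 * 2 ^ q * h

end StieltjesSum

open StieltjesSum in
theorem mainTheorem11 (n : ℕ) (a : ℂ)
    (ha : ∀ j : ℕ, 1 ≤ j → (2 : ℂ) ^ n * a ≠ -(j : ℂ)) :
    ∑ p ∈ Finset.range (n + 1),
        (Complex.log (Complex.I * (2 : ℂ) ^ (1 - (p : ℤ))) *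
            (harmonicNumber ((2 : ℂ) ^ ((p : ℤ) - 2) * a)
              - harmonicNumber (1 / 4 * ((2 : ℂ) ^ p * a - 2)))
          + 2 * Complex.log (Complex.I * (2 : ℂ) ^ (-(p : ℤ))) *
            (harmonicNumber (1 / 2 * ((2 : ℂ) ^ p * a - 1))
              - harmonicNumber ((2 : ℂ) ^ ((p : ℤ) - 1) * a))
          - stieltjes 1 ((2 : ℂ) ^ ((p : ℤ) - 2) * a + 1)
          + 2 * stieltjes 1 ((2 : ℂ) ^ ((p : ℤ) - 1) * a + 1)
          - 2 * stieltjes 1 (1 / 2 * ((2 : ℂ) ^ p * a + 1))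
          + stieltjes 1 (1 / 4 * ((2 : ℂ) ^ p * a + 2)))
      = 1 / 4 *
        (-8 * stieltjes 1 (1 / 2 * ((2 : ℂ) ^ n * a + 1))
          + 8 * Complex.log (Complex.I * (2 : ℂ) ^ (-(n : ℤ))) *
            Complex.digamma (1 / 2 * ((2 : ℂ) ^ n * a + 1))
          + 8 * stieltjes 1 ((a + 2) / 4)
          + (-8 * Complex.log 2 - 4 * Complex.I * (Real.pi : ℂ)) *
            Complex.digamma ((a + 2) / 4)
          + 4 * Complex.log (Complex.I * (2 : ℂ) ^ (-(n : ℤ))) ^ 2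
          + ((Real.pi : ℂ) - 2 * Complex.I * Complex.log 2) ^ 2) := by
  let U : ℕ → ℂ := fun p => stieltjesPotential
    (Complex.log (Complex.I * (2 : ℂ) ^ (1 - (p : ℤ)))) (1 / 4 * ((2 : ℂ) ^ p * a + 2))
  have hU_succ (p : ℕ) : U (p + 1) = stieltjesPotential
      (Complex.log (Complex.I * (2 : ℂ) ^ (-(p : ℤ)))) (1 / 2 * ((2 : ℂ) ^ p * a + 1)) := by
    simp only [U]
    congr! 1
    · congr! 3
      push_cast
      ring
    · ring
  have hquarter (p : ℕ) : (2 : ℂ) ^ ((p : ℤ) - 2) * a = 2 ^ p * a / 4 := by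
    rw [zpow_sub₀ two_ne_zero, zpow_natCast]; norm_num; ring
  have hhalf (p : ℕ) : (2 : ℂ) ^ ((p : ℤ) - 1) * a = 2 ^ p * a / 2 := by
    rw [zpow_sub_one₀ two_ne_zero, zpow_natCast]; ring
  refine (Finset.sum_congr rfl fun p hp => (?_ : _ = U (p + 1) - U p)).trans ?_
  · have hpn : p ≤ n := Nat.lt_succ_iff.1 (Finset.mem_range.1 hp)
    rw [hU_succ, hquarter, hhalf, log_I_mul_two_zpow_neg]
    exact stieltjesPotential_sub _ (two_pow_mul_div_two_add_one_ne_neg_natCast ha hpn)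
  · have hlog_zero := log_I_mul_two_zpow 1
    have hw_zero : 1 / 4 * ((2 : ℂ) ^ 0 * a + 2) = (a + 2) / 4 := by ring
    rw [Finset.sum_range_sub, hU_succ]
    simp only [U, stieltjesPotential, hw_zero, Nat.cast_zero, sub_zero, hlog_zero]
    push_cast
    linear_combination (-Complex.log 2 ^ 2 - (Real.pi : ℂ) ^ 2 / 4) * Complex.I_sq
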